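/- Let $\Sigma=\{0,1\}$ and let $\mu$ be the uniform (fair-coin product) measure on $\{0,1\}^{\mathbb N}$. For a language $L\subseteq\Sigma^*$ let $[L]\subseteq\{0,1\}^{\mathbb N}$ be the set of infinite sequences having a prefix in $L$. An automatic family $\mathcal U=(U_i)_{i\in I}$ consists of a regular index language $I\subseteq\Sigma^*$ and languages $U_i\subseteq\Sigma^*$ such that $\{(x,i): i\in I,\ x\in U_i\}$ is an automatic relation, i.e. a finite automaton recognizes the pairs $(x,i)$ when $x$ and $i$ are read synchronously, the shorter word being padded at its end with a blank symbol. It is an automatic randomness test (ART) if $\liminf_{i\in I}\mu[U_i]=0$ (the lower limit as $|i|\to\infty$, so that $I$ is infinite). Its covering region is $F(\mathcal U)=\bigcap_{i\in I}[U_i]$. Theorem. For every ART $\mathcal U$ there are an ART $\mathcal V=(V_j)_{j\in J}$ with $F(\mathcal U)\subseteq F(\mathcal V)$ and a real number $\gamma$ with $0<\gamma<1$ such that $$\mu[V_j]\le\gamma^{|j|}\quad\text{for all } j\in J.$$ Moreover, $\mathcal V$ can be chosen as follows for some nonempty word $w\in\Sigma^*$: $J=\{0^{|w|k}: k\ge 1\}$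 and, for each $j\in J$, $V_j$ is the set of words of length $|j|$ that do not contain $w$ as a subword (block of consecutive letters). -/

import Mathlib

open MeasureTheory

/-- The block form of a pair of words: the letters are written one above the other and the shorter
word is padded at its end with the blank symbol `none`, up to the length of the longer word. -/
def blockForm (x y : List Bool) : List (Option Bool × Option Bool) :=
  List.zipWithAll Prod.mk x y

/-- A binary relation on words is automatic if some finite automaton recognizes exactly the block
forms of its elements, among all block forms of pairs of words. -/
def IsAutomaticRel (R : List Bool → List Bool → Prop) : Prop :=
  ∃ L : Language (Option Bool × Option Bool), L.IsRegular ∧ ∀ x y, R x y ↔ blockForm x y ∈ L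

/-- An automatic family `(U_i)_{i ∈ I}` of languages over the alphabet `{0, 1}`
(`false` is `0`, `true` is `1`): the index set `I` is a regular language and
`{(x, i) | i ∈ I, x ∈ U_i}` is an automatic relation. -/
structure AutomaticFamily where
  /-- The set of indices. -/
  index : Language Bool
  /-- The members of the family. -/
  lang : {i : List Bool // i ∈ index} → Language Bool
  index_isRegular : index.IsRegular
  isAutomatic : IsAutomaticRel fun x i => ∃ h : i ∈ index, x ∈ lang ⟨i, h⟩

/-- The word `w` is a prefix of the infinite sequence `X`. -/
def IsPrefixOfSeq (w : List Bool) (X : ℕ → Bool) : Prop :=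
  ∀ (n : ℕ) (h : n < w.length), X n = w[n]

/-- The open class `[L]` of all infinite sequences that extend some word of `L`. -/
def openClass (L : Language Bool) : Set (ℕ → Bool) :=
  {X | ∃ w ∈ L, IsPrefixOfSeq w X}

/-- Lebesgue measure on the Cantor space: the infinite product of the equiprobable measure
on `{0, 1}`. -/
noncomputable def cantorMeasure : Measure (ℕ → Bool) :=
  Measure.infinitePi fun _ : ℕ => (PMF.uniformOfFintype Bool).toMeasure

/-- An automatic family is an automatic randomness test if `liminf_{i ∈ I} μ[U_i] = 0`, the lower
limit being taken as `i` leaves every finite subset of `I` (equivalently, `|i| → ∞`). For a finite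
index set the lower limit in `[0, ∞]` is `∞`, so the index set of a test is infinite. -/
def AutomaticFamily.IsART (U : AutomaticFamily) : Prop :=
  Filter.liminf (fun i => cantorMeasure (openClass (U.lang i))) Filter.cofinite = 0

/-- The covering region `F(U) = ⋂_{i ∈ I} [U_i]`. -/
def AutomaticFamily.coveringRegion (U : AutomaticFamily) : Set (ℕ → Bool) :=
  ⋂ i, openClass (U.lang i)

/-- The words of length `n` that do not contain `w` as a subword (a block of consecutive
letters). -/
def avoiding (w : List Bool) (n : ℕ) : Language Bool :=
  {x | x.length = n ∧ ¬ w <:+: x}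

/-! It is enough to find a word `w` such that no sequence containing `w` lies in the covering region
(`IsART.exists_word`). The words avoiding `w` then form the new test: disjoint blocks of length `m =
|w|` are independent, so `k` of them all differ from `w` with probability `(1 - 2⁻ᵐ)ᵏ = γ^(m k)`.

Every `p` has an extension whose cylinder misses some `[U_i]` (`IsART.exists_misses`): take `i` with
`μ[U_i]` below the measure of the cylinder of `p`. An arbitrary dense open set may have small
measure, but for fixed `i` finitely many states govern `U_i` beyond length `|i|`, so density in the
cylinder would imply full measure there (`ae_mem_openClass`).

The extension can be made independent of `p`, because missing depends only on finitely many data of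
the automata (`misses_congr`). `exists_uniform_word` treats these colours one after another; it
serves in both places. -/

/-- If the property `P a w` of words is monotone in `w` and can be forced by an extension of any
word simultaneously for all `a` of one colour, then finitely many colours admit a common word. -/
theorem exists_uniform_word {α C : Type*} [Finite C] (f : α → C) (P : α → List Bool → Prop)
    (mono : ∀ a w z, P a w → P a (w ++ z))
    (h : ∀ c w, ∃ z, ∀ a, f a = c → P a (w ++ z)) : ∃ w, ∀ a, P a w := by
  classical
  cases nonempty_fintype C
  suffices H : ∀ s : Finset C, ∃ w, ∀ a, f a ∈ s → P a w by
    obtain ⟨w, hw⟩ := H Finset.univ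
    exact ⟨w, fun a => hw a (Finset.mem_univ _)⟩
  intro s
  induction s using Finset.induction_on with
  | empty => exact ⟨[], by simp⟩
  | insert c s _ ih =>
    obtain ⟨w, hw⟩ := ih
    obtain ⟨z, hz⟩ := h c w
    refine ⟨w ++ z, fun a ha => ?_⟩
    rcases Finset.mem_insert.1 ha with hc | hs
    · exact hz a hc
    · exact mono a w z (hw a hs)

/-! ### Prefixes of sequences -/

theorem IsPrefixOfSeq.of_prefix {v w : List Bool} {X : ℕ → Bool} (hw : IsPrefixOfSeq w X)
    (h : v <+: w) : IsPrefixOfSeq v X := fun n hn => by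
  rw [hw n (hn.trans_le h.length_le)]
  exact (h.getElem hn).symm

theorem IsPrefixOfSeq.prefix_of_length_le {v w : List Bool} {X : ℕ → Bool}
    (hv : IsPrefixOfSeq v X) (hw : IsPrefixOfSeq w X) (h : v.length ≤ w.length) : v <+: w := by
  rw [List.prefix_iff_getElem]
  exact ⟨h, fun n hn => by rw [← hv n hn, ← hw n (hn.trans_le h)]⟩

theorem IsPrefixOfSeq.prefix_or_prefix {v w : List Bool} {X : ℕ → Bool}
    (hv : IsPrefixOfSeq v X) (hw : IsPrefixOfSeq w X) : v <+: w ∨ w <+: v :=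
  (le_total v.length w.length).imp (hv.prefix_of_length_le hw) (hw.prefix_of_length_le hv)

/-- The prefix of length `n` of a sequence. -/
def seqPrefix (X : ℕ → Bool) (n : ℕ) : List Bool := (List.range n).map X

@[simp] theorem length_seqPrefix (X : ℕ → Bool) (n : ℕ) : (seqPrefix X n).length = n := by
  simp [seqPrefix]

theorem isPrefixOfSeq_seqPrefix (X : ℕ → Bool) (n : ℕ) : IsPrefixOfSeq (seqPrefix X n) X := by
  intro k hk
  simp [seqPrefix]

theorem isPrefixOfSeq_append {u w : List Bool} {X : ℕ → Bool} :
    IsPrefixOfSeq (u ++ w) X ↔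
      IsPrefixOfSeq u X ∧ ∀ (t : ℕ) (h : t < w.length), X (u.length + t) = w[t] := by
  constructor
  · refine fun h => ⟨h.of_prefix (List.prefix_append _ _), fun t ht => ?_⟩
    rw [h (u.length + t) (by simpa using ht)]
    simp
  · rintro ⟨h1, h2⟩ n hn
    rw [List.getElem_append]
    split_ifs with h
    · exact h1 n h
    · have hn' : n - u.length < w.length := by simp at hn; omega
      rw [← h2 _ hn']
      congr 1; omega

/-! ### Block events -/

/-- The sequences whose `k`-th block of length `|w|` is `w`. -/
def blockEvent (w : List Bool) (k : ℕ) : Set (ℕ → Bool) :=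
  Set.pi (Finset.Ico (w.length * k) (w.length * k + w.length) : Finset ℕ)
    -- Blocks start at multiples of `|w|`, so the remainder is the offset in the block; the default
    -- is never reached.
    fun n => {w.getD (n % w.length) false}

theorem mem_blockEvent {w : List Bool} {k : ℕ} {X : ℕ → Bool} :
    X ∈ blockEvent w k ↔ ∀ (t : ℕ) (h : t < w.length), X (w.length * k + t) = w[t] := by
  simp only [blockEvent, Set.mem_pi, Finset.mem_coe, Finset.mem_Ico, Set.mem_singleton_iff]
  constructor
  · intro h t ht
    rw [h _ ⟨by omega, by omega⟩, Nat.mul_add_mod, Nat.mod_eq_of_lt ht]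
    simp [ht]
  · rintro h n ⟨h1, h2⟩
    obtain ⟨t, rfl⟩ := Nat.exists_eq_add_of_le h1
    have ht : t < w.length := by omega
    rw [h t ht, Nat.mul_add_mod, Nat.mod_eq_of_lt ht]
    simp [ht]

theorem mem_blockEvent_iff_seqPrefix {w : List Bool} {k : ℕ} {X : ℕ → Bool} :
    X ∈ blockEvent w k ↔ IsPrefixOfSeq (seqPrefix X (w.length * k) ++ w) X := by
  rw [isPrefixOfSeq_append, mem_blockEvent]
  simp [isPrefixOfSeq_seqPrefix]

theorem blockEvent_zero (w : List Bool) : blockEvent w 0 = {X | IsPrefixOfSeq w X} := by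
  ext X
  simp [mem_blockEvent, IsPrefixOfSeq]

theorem measurableSet_blockEvent (w : List Bool) (k : ℕ) : MeasurableSet (blockEvent w k) :=
  MeasurableSet.pi (Finset.countable_toSet _) fun _ _ => measurableSet_singleton _

instance : IsProbabilityMeasure cantorMeasure := by
  unfold cantorMeasure; infer_instance

theorem cantorMeasure_pi (s : Finset ℕ) (f : ℕ → Bool) :
    cantorMeasure (Set.pi (s : Set ℕ) fun n => {f n}) = ∏ _n ∈ s, (2 : ENNReal)⁻¹ := by
  rw [cantorMeasure, Measure.infinitePi_pi _ fun _ _ => measurableSet_singleton _]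
  refine Finset.prod_congr rfl fun n _ => ?_
  rw [PMF.toMeasure_apply_singleton _ _ (measurableSet_singleton _)]
  simp

theorem cantorMeasure_blockEvent (w : List Bool) (k : ℕ) :
    cantorMeasure (blockEvent w k) = 2⁻¹ ^ w.length := by
  rw [blockEvent, cantorMeasure_pi]
  simp

/-- Different blocks constrain disjoint sets of coordinates. -/
theorem iIndepSet_blockEvent (w : List Bool) :
    ProbabilityTheory.iIndepSet (blockEvent w) cantorMeasure := by
  rw [ProbabilityTheory.iIndepSet_iff_meas_biInter (measurableSet_blockEvent w)]
  intro S
  have hdisj : (S : Set ℕ).PairwiseDisjoint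
      fun k => Finset.Ico (w.length * k) (w.length * k + w.length) := by
    intro k _ l _ hkl
    rw [Function.onFun, Finset.disjoint_left]
    intro n hn hn'
    simp only [Finset.mem_Ico] at hn hn'
    have key : ∀ k, w.length * k ≤ n → n < w.length * k + w.length → n / w.length = k := by
      intro k h1 h2
      exact Nat.div_eq_of_lt_le (by rwa [mul_comm]) (by rwa [mul_comm, Nat.mul_succ])
    exact hkl ((key k hn.1 hn.2).symm.trans (key l hn'.1 hn'.2))
  have hS : ⋂ k ∈ S, blockEvent w k =
      Set.pi (S.biUnion fun k => Finset.Ico (w.length * k) (w.length * k + w.length) : Finset ℕ)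
        fun n => {w.getD (n % w.length) false} := by
    ext X
    simp only [blockEvent, Set.mem_iInter, Set.mem_pi, Finset.mem_coe, Finset.mem_biUnion]
    exact ⟨fun h n ⟨k, hk, hn⟩ => h k hk n hn, fun h k hk n hn => h n ⟨k, hk, hn⟩⟩
  rw [hS, cantorMeasure_pi, Finset.prod_biUnion hdisj]
  simp [cantorMeasure_blockEvent]

theorem cantorMeasure_biInter_compl_blockEvent (w : List Bool) (k : ℕ) :
    cantorMeasure (⋂ l ∈ Finset.range k, (blockEvent w l)ᶜ) = (1 - 2⁻¹ ^ w.length) ^ k := by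
  have h : ProbabilityTheory.iIndep (fun l => MeasurableSpace.generateFrom {blockEvent w l})
      cantorMeasure := iIndepSet_blockEvent w
  rw [h.meas_biInter fun l _ =>
    (MeasurableSpace.measurableSet_generateFrom (Set.mem_singleton _)).compl]
  simp [prob_compl_eq_one_sub (measurableSet_blockEvent w _), cantorMeasure_blockEvent]

/-- Second Borel–Cantelli lemma: the events are independent and of constant positive probability. -/
theorem ae_frequently_mem_blockEvent (w : List Bool) :
    ∀ᵐ X ∂cantorMeasure, ∃ᶠ k in Filter.atTop, X ∈ blockEvent w k := by
  have h := ProbabilityTheory.measure_limsup_eq_one (measurableSet_blockEvent w)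
    (iIndepSet_blockEvent w) (by
      simp only [cantorMeasure_blockEvent]
      exact ENNReal.tsum_const_eq_top_of_ne_zero (by simp))
  have h' := (prob_compl_eq_zero_iff (MeasurableSet.measurableSet_limsup
    (measurableSet_blockEvent w))).2 h
  rw [ae_iff]
  convert h' using 2
  ext X
  simp [Filter.mem_limsup_iff_frequently_mem]

/-! ### The measure of the class of words avoiding a word -/

theorem openClass_avoiding_subset (w : List Bool) (k : ℕ) :
    openClass (avoiding w (w.length * k)) ⊆ ⋂ l ∈ Finset.range k, (blockEvent w l)ᶜ := by
  rintro X ⟨x, ⟨hx, hw⟩, hX⟩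
  simp only [Set.mem_iInter, Finset.mem_range, Set.mem_compl_iff]
  intro l hl hXl
  rw [mem_blockEvent_iff_seqPrefix] at hXl
  have hle : w.length * l + w.length ≤ w.length * k := by
    rw [← Nat.mul_succ]; exact Nat.mul_le_mul_left _ hl
  have := hXl.prefix_of_length_le hX (by simpa [hx] using hle)
  exact hw ((List.suffix_append _ _).isInfix.trans this.isInfix)

theorem cantorMeasure_openClass_avoiding_le (w : List Bool) (k : ℕ) :
    cantorMeasure (openClass (avoiding w (w.length * k))) ≤
      ENNReal.ofReal ((1 - 2⁻¹ ^ w.length) ^ k) := by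
  refine (measure_mono (openClass_avoiding_subset w k)).trans_eq ?_
  rw [cantorMeasure_biInter_compl_blockEvent, ENNReal.ofReal_pow,
    ENNReal.ofReal_sub _ (by positivity), ENNReal.ofReal_pow (by norm_num),
    ENNReal.ofReal_inv_of_pos (by norm_num)]
  · simp
  · rw [sub_nonneg]; exact pow_le_one₀ (by norm_num) (by norm_num)

/-! ### Regularity of the test that avoids a word -/

theorem List.infix_append_iff_or {α : Type*} {w u y : List α} :
    w <:+: u ++ y ↔ w <:+: u ∨ w <:+: y ∨ ∃ s t, s ++ t = w ∧ s <:+ u ∧ t <+: y := by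
  constructor
  · rintro ⟨a, b, h⟩
    rw [List.append_assoc, List.append_eq_append_iff] at h
    rcases h with ⟨c, rfl, h⟩ | ⟨c, rfl, h⟩
    · rcases List.append_eq_append_iff.1 h with ⟨d, rfl, rfl⟩ | ⟨d, rfl, rfl⟩
      · exact .inl ⟨a, d, by simp⟩
      · exact .inr (.inr ⟨c, d, rfl, List.suffix_append _ _, List.prefix_append _ _⟩)
    · exact .inr (.inl ⟨c, b, by simp [h]⟩)
  · rintro (h | h | ⟨s, t, rfl, ⟨a, rfl⟩, ⟨b, rfl⟩⟩)
    · exact List.infix_append_of_infix_left h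
    · exact List.infix_append_of_infix_right h
    · exact ⟨a, b, by simp⟩

/-- A language is regular if a colouring of the words by finitely many colours determines their
left quotients. -/
theorem Language.IsRegular.of_finite_coloring {α C : Type*} [Finite C] {L : Language α}
    (f : List α → C) (h : ∀ u v y, f u = f v → u ++ y ∈ L → v ++ y ∈ L) : L.IsRegular := by
  have hf : ∀ u v, f u = f v → L.leftQuotient u = L.leftQuotient v := fun u v huv =>
    Set.ext fun y => ⟨h u v y huv, h v u y huv.symm⟩
  refine .of_finite_range_leftQuotient ((Set.toFinite (Set.range
    fun c : Set.range f => L.leftQuotient c.2.choose)).subset ?_)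
  rintro _ ⟨u, rfl⟩
  exact ⟨⟨f u, u, rfl⟩, hf _ _ (Exists.choose_spec (p := fun v => f v = f u) ⟨u, rfl⟩)⟩

theorem isRegular_not_infix {α : Type*} (w : List α) :
    Language.IsRegular ({x | ¬ w <:+: x} : Language α) := by
  -- An occurrence of `w` across the cut is seen from the left only through the prefixes of `w` that
  -- end `u`.
  refine .of_finite_coloring (C := Prop × Set (Fin (w.length + 1)))
    (fun u => (w <:+: u, {k | w.take k <:+ u})) fun u v y huv hu => ?_
  simp only [Prod.mk.injEq, Set.ext_iff, Set.mem_ofPred_eq, eq_iff_iff] at huv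
  change ¬ _ at hu
  change ¬ _
  rw [List.infix_append_iff_or] at hu ⊢
  rw [← huv.1]
  refine fun h => hu (h.imp_right (Or.imp_right ?_))
  rintro ⟨s, t, rfl, hs, ht⟩
  have := huv.2 ⟨s.length, by simp⟩
  exact ⟨s, t, rfl, by simpa using this.2 (by simpa using hs), ht⟩

theorem isRegular_forall_mem {α : Type*} (p : α → Prop) :
    Language.IsRegular ({x | ∀ a ∈ x, p a} : Language α) := by
  refine .of_finite_coloring (fun u => ∀ a ∈ u, p a) fun u v y huv hu => ?_
  change ∀ a ∈ _, _ at hu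
  change ∀ a ∈ _, _
  simp only [List.forall_mem_append] at hu ⊢
  exact ⟨(eq_iff_iff.1 huv).1 hu.1, hu.2⟩

theorem isRegular_dvd_length {α : Type*} (m : ℕ) (hm : m ≠ 0) :
    Language.IsRegular ({x | m ∣ x.length} : Language α) := by
  have : NeZero m := ⟨hm⟩
  refine .of_finite_coloring (fun u => (u.length : ZMod m)) fun u v y huv hu => ?_
  change m ∣ _ at hu
  change m ∣ _
  rw [← ZMod.natCast_eq_zero_iff, List.length_append, Nat.cast_add] at hu ⊢
  rwa [← huv]

theorem isRegular_ne_nil {α : Type*} : Language.IsRegular ({x | x ≠ []} : Language α) := by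
  refine .of_finite_coloring (fun u => u = []) fun u v y huv hu => ?_
  change _ ≠ _ at hu
  change _ ≠ _
  have := eq_iff_iff.1 huv
  simp only [ne_eq, List.append_eq_nil_iff] at hu ⊢
  tauto

theorem Language.IsRegular.comap_map {α β : Type*} {L : Language β} (hL : L.IsRegular) (f : α → β) :
    Language.IsRegular ({x | x.map f ∈ L} : Language α) := by
  obtain ⟨σ, _, M, rfl⟩ := hL
  exact ⟨σ, inferInstance, M.comap f, M.accepts_comap f⟩

theorem forall_mem_blockForm_iff {x y : List Bool} :
    (∀ c ∈ blockForm x y, c.1.isSome ∧ c.2 = some false) ↔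
      y = List.replicate x.length false := by
  induction x generalizing y with
  | nil => cases y <;> simp [blockForm]
  | cons a x ih =>
    cases y with
    | nil => simp [blockForm]
    | cons b y =>
      have h : blockForm (a :: x) (b :: y) = (some a, some b) :: blockForm x y := rfl
      rw [h, List.forall_mem_cons, ih]
      simp [List.replicate_succ]

theorem length_blockForm (x y : List Bool) : (blockForm x y).length = max x.length y.length := by
  induction x generalizing y with
  | nil => simp [blockForm]
  | cons a x ih =>
    cases y with
    | nil => simp [blockForm]
    | cons b y =>
      have := @ih y
      unfold blockForm at *
      simp [this]

theorem map_fst_blockForm_replicate (x : List Bool) :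
    (blockForm x (List.replicate x.length false)).map (fun c => c.1.getD false) = x := by
  induction x with
  | nil => simp [blockForm]
  | cons a x ih =>
    unfold blockForm at *
    simp [ih, List.replicate_succ]

/-- The words `0 ^ (m * k)`, `k ≥ 1`. -/
def zeroWords (m : ℕ) : Language Bool :=
  {j | ∃ k : ℕ, 1 ≤ k ∧ j = List.replicate (m * k) false}

theorem mem_zeroWords_iff {m : ℕ} (hm : m ≠ 0) {j : List Bool} :
    j ∈ zeroWords m ↔ (∀ a ∈ j, a = false) ∧ m ∣ j.length ∧ j ≠ [] := by
  constructor
  · rintro ⟨k, hk, rfl⟩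
    refine ⟨fun a => List.eq_of_mem_replicate, by simp, ?_⟩
    simp only [ne_eq, List.replicate_eq_nil_iff, mul_eq_zero]
    omega
  · rintro ⟨h1, ⟨k, hk⟩, h3⟩
    refine ⟨k, Nat.one_le_iff_ne_zero.2 ?_, ?_⟩
    · rintro rfl
      exact h3 (List.eq_nil_of_length_eq_zero hk)
    · rw [← hk]; exact List.eq_replicate_of_mem h1

theorem isRegular_zeroWords {m : ℕ} (hm : m ≠ 0) : (zeroWords m).IsRegular := by
  convert (isRegular_forall_mem fun a => a = false).inf
    ((isRegular_dvd_length m hm).inf isRegular_ne_nil) using 1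
  ext j
  exact mem_zeroWords_iff hm

/-- The automatic family of the languages of words of length `|w| * k` that avoid `w`. -/
def avoidingFamily (w : List Bool) (hw : w ≠ []) : AutomaticFamily where
  index := zeroWords w.length
  lang j := avoiding w (j : List Bool).length
  index_isRegular := isRegular_zeroWords (by simpa using hw)
  isAutomatic := by
    have hm : w.length ≠ 0 := by simpa using hw
    -- The letterwise condition forces `j = 0^|x|`; hence the block form has the length of `j`, its
    -- first track is `x`, and the default of `getD` is never used.
    refine ⟨_, (isRegular_forall_mem fun c : Option Bool × Option Bool =>
      c.1.isSome ∧ c.2 = some false).inf (((isRegular_dvd_length w.length hm).inf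
        isRegular_ne_nil).inf ((isRegular_not_infix w).comap_map fun c => c.1.getD false)),
      fun x j => ?_⟩
    change _ ↔ (∀ c ∈ blockForm x j, _) ∧ (_ ∣ (blockForm x j).length ∧ blockForm x j ≠ []) ∧
      ¬ w <:+: (blockForm x j).map _
    change (∃ _ : j ∈ zeroWords w.length, x.length = j.length ∧ ¬ w <:+: x) ↔ _
    rw [forall_mem_blockForm_iff, exists_prop, mem_zeroWords_iff hm, ← List.length_pos_iff,
      ← List.length_pos_iff, length_blockForm]
    constructor
    · rintro ⟨⟨h1, h2, h3⟩, h4, h5⟩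
      obtain rfl : j = List.replicate x.length false := by
        rw [h4]; exact List.eq_replicate_of_mem h1
      rw [map_fst_blockForm_replicate]
      refine ⟨rfl, ?_, h5⟩
      simpa using And.intro h2 h3
    · rintro ⟨rfl, h2, h5⟩
      rw [map_fst_blockForm_replicate] at h5
      refine ⟨⟨fun a => List.eq_of_mem_replicate, ?_⟩, ?_, h5⟩
      · simpa using h2
      · simp

theorem infinite_zeroWords {m : ℕ} (hm : m ≠ 0) : Infinite {j // j ∈ zeroWords m} := by
  refine Infinite.of_injective
    (fun k : ℕ => (⟨List.replicate (m * (k + 1)) false, k + 1, by omega, rfl⟩ :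
      {j // j ∈ zeroWords m})) fun k l h => ?_
  have := congrArg (fun j : {j // j ∈ zeroWords m} => j.1.length) h
  simpa [hm] using this

/-! ### Block forms of concatenations -/

theorem blockForm_append {x y : List Bool} (h : x.length = y.length) (x' y' : List Bool) :
    blockForm (x ++ x') (y ++ y') = blockForm x y ++ blockForm x' y' := by
  induction x generalizing y with
  | nil =>
    obtain rfl : y = [] := List.eq_nil_of_length_eq_zero h.symm
    simp [blockForm]
  | cons a x ih =>
    cases y with
    | nil => simp at h
    | cons b y => exact congrArg _ (ih (by simpa using h))

theorem blockForm_append_left {x y : List Bool} (h : y.length ≤ x.length) (x' : List Bool) :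
    blockForm (x ++ x') y = blockForm x y ++ blockForm x' [] := by
  induction x generalizing y with
  | nil =>
    obtain rfl : y = [] := List.eq_nil_of_length_eq_zero (by simpa using h)
    simp [blockForm]
  | cons a x ih =>
    cases y with
    | nil => simp [blockForm]
    | cons b y => exact congrArg _ (ih (by simpa using h))

theorem blockForm_append_right {x y : List Bool} (h : x.length ≤ y.length) (y' : List Bool) :
    blockForm x (y ++ y') = blockForm x y ++ blockForm [] y' := by
  induction x generalizing y with
  | nil => simp [blockForm]
  | cons a x ih =>
    cases y with
    | nil => simp at h
    | cons b y => exact congrArg _ (ih (by simpa using h))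

/-! ### Comparable words and almost sure covering -/

/-- Two words are comparable if one of them is a prefix of the other. -/
def PrefixComparable (x p : List Bool) : Prop := x <+: p ∨ p <+: x

theorem prefixComparable_append_iff {x p y : List Bool} :
    PrefixComparable x (p ++ y) ↔ x <+: p ∨ ∃ z, x = p ++ z ∧ PrefixComparable z y := by
  constructor
  · rintro (h | ⟨z, rfl⟩)
    · rcases List.prefix_or_prefix_of_prefix h (List.prefix_append p y) with h' | ⟨z, rfl⟩
      · exact .inl h'
      · exact .inr ⟨z, rfl, .inl ((List.prefix_append_right_inj p).1 h)⟩
    · exact .inr ⟨y ++ z, by simp, .inr (List.prefix_append _ _)⟩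
  · rintro (h | ⟨z, rfl, h⟩)
    · exact .inl (h.trans (List.prefix_append _ _))
    · exact h.imp (List.prefix_append_right_inj p).2 (List.prefix_append_right_inj p).2

/-- If membership in `K` beyond length `n` is controlled by finitely many colours and every
extension of `p` is comparable with a word of `K`, then almost every sequence extending `p` has a
prefix in `K`. -/
theorem ae_mem_openClass {K : Language Bool} {C : Type*} [Finite C] (f : List Bool → C) (n : ℕ)
    (hf : ∀ u v z : List Bool, n ≤ u.length → n ≤ v.length → f u = f v → u ++ z ∈ K → v ++ z ∈ K)
    (p : List Bool) (hp : ∀ u, p <+: u → ∃ x ∈ K, PrefixComparable x u) :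
    ∀ᵐ X ∂cantorMeasure, IsPrefixOfSeq p X → X ∈ openClass K := by
  -- Only words `u` without a prefix in `K` are coloured: a word of `K` comparable with an extension
  -- of `u` then has the form `u ++ z`, and `z` serves every word of the same colour.
  obtain ⟨w, hw⟩ := exists_uniform_word
    (α := {u : List Bool // p <+: u ∧ n ≤ u.length ∧ ∀ x ∈ K, ¬ x <+: u})
    (fun u => f u) (fun u w => ∃ x ∈ K, x <+: (u : List Bool) ++ w)
    (fun u w z ⟨x, hx, h⟩ => ⟨x, hx, by
      rw [← List.append_assoc]; exact h.trans (List.prefix_append _ _)⟩) (by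
    intro c w
    by_cases hc : ∃ u : {u : List Bool // p <+: u ∧ n ≤ u.length ∧ ∀ x ∈ K, ¬ x <+: u}, f u = c
    · obtain ⟨⟨u, hpu, hnu, hKu⟩, rfl⟩ := hc
      obtain ⟨x, hxK, hx⟩ := hp (u ++ w) (hpu.trans (List.prefix_append _ _))
      rcases prefixComparable_append_iff.1 hx with h | ⟨z, rfl, h⟩
      · exact absurd h (hKu x hxK)
      · have key : ∃ y, z <+: w ++ y := by
          rcases h with h | ⟨y, rfl⟩
          · exact ⟨[], by simpa using h⟩
          · exact ⟨y, List.prefix_rfl⟩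
        obtain ⟨y, hy⟩ := key
        exact ⟨y, fun v hv => ⟨v ++ z, hf u v z hnu v.2.2.1 hv.symm hxK,
          (List.prefix_append_right_inj _).2 hy⟩⟩
    · exact ⟨[], fun u hu => absurd ⟨u, hu⟩ hc⟩)
  -- The added letter makes the block nonempty, so that block `k` starts at position `k` or later.
  filter_upwards [ae_frequently_mem_blockEvent (w ++ [false])] with X hX hpX
  obtain ⟨k, hk, hXk⟩ := Filter.frequently_atTop.1 hX (n + p.length)
  rw [mem_blockEvent_iff_seqPrefix] at hXk
  set u := seqPrefix X ((w ++ [false]).length * k) with hu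
  have hlen : n + p.length ≤ u.length := by
    rw [hu, length_seqPrefix, List.length_append, List.length_singleton, Nat.succ_mul]
    omega
  have huX : IsPrefixOfSeq u X := isPrefixOfSeq_seqPrefix _ _
  by_cases hK : ∀ x ∈ K, ¬ x <+: u
  · obtain ⟨x, hxK, hx⟩ := hw ⟨u, hpX.prefix_of_length_le huX (by omega), by omega, hK⟩
    refine ⟨x, hxK, hXk.of_prefix (hx.trans ?_)⟩
    rw [← List.append_assoc]
    exact List.prefix_append _ _
  · push Not at hK
    obtain ⟨x, hxK, hx⟩ := hK
    exact ⟨x, hxK, huX.of_prefix hx⟩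

/-! ### Cylinders missed by a member of a test -/

namespace AutomaticFamily

variable (U : AutomaticFamily)

/-- The cylinder of the word `p` is disjoint from the open class of `U_i`. -/
def Misses (p i : List Bool) : Prop :=
  ∃ h : i ∈ U.index, ∀ x ∈ U.lang ⟨i, h⟩, ¬ PrefixComparable x p

variable {U} in
theorem Misses.append {p i : List Bool} (h : U.Misses p i) (z : List Bool) :
    U.Misses (p ++ z) i := by
  obtain ⟨hi, h⟩ := h
  refine ⟨hi, fun x hx hc => h x hx ?_⟩
  rcases prefixComparable_append_iff.1 hc with h | ⟨z, rfl, -⟩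
  · exact .inl h
  · exact .inr (List.prefix_append _ _)

variable {U} in
theorem Misses.notMem_coveringRegion {p i : List Bool} (h : U.Misses p i) {X : ℕ → Bool}
    (hX : IsPrefixOfSeq p X) : X ∉ U.coveringRegion := by
  obtain ⟨hi, h⟩ := h
  intro hXU
  obtain ⟨x, hx, hxX⟩ := Set.mem_iInter.1 hXU ⟨i, hi⟩
  exact h x hx (hxX.prefix_or_prefix hX)

variable {U} in
theorem IsART.exists_misses (hU : U.IsART) (p : List Bool) :
    ∃ v i, p.length ≤ i.length ∧ U.Misses (p ++ v) i := by
  have hpos : 0 < cantorMeasure {X | IsPrefixOfSeq p X} := by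
    rw [← blockEvent_zero, cantorMeasure_blockEvent]
    exact pos_iff_ne_zero.2 (by simp)
  have hfreq : ∃ᶠ i in Filter.cofinite,
      cantorMeasure (openClass (U.lang i)) < cantorMeasure {X | IsPrefixOfSeq p X} :=
    Filter.frequently_lt_of_liminf_lt (by isBoundedDefault) (hU.trans_lt hpos)
  have hev : ∀ᶠ i : {i // i ∈ U.index} in Filter.cofinite, p.length ≤ (i : List Bool).length := by
    have := (List.finite_length_lt Bool p.length).preimage
      (Subtype.val_injective (p := fun i => i ∈ U.index)).injOn
    refine Filter.mem_cofinite.2 (this.subset fun i hi => ?_)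
    simpa using hi
  obtain ⟨⟨i, hi⟩, hlt, hlen⟩ := (hfreq.and_eventually hev).exists
  by_contra! hno
  obtain ⟨L, ⟨σ, _, M, rfl⟩, hM⟩ := U.isAutomatic
  refine hlt.not_ge (measure_mono_ae ?_)
  -- Once `i` has been read, only blanks stand below the letters, so the state of `M` is a valid
  -- colour.
  refine ae_mem_openClass (fun u => M.eval (blockForm u i)) i.length ?_ p ?_
  · intro u v z hu hv huv hz
    have := (hM _ _).1 ⟨hi, hz⟩
    obtain ⟨_, h⟩ := (hM (v ++ z) i).2 (by
      rw [blockForm_append_left hu, DFA.mem_accepts, DFA.eval, DFA.evalFrom_of_append] at this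
      rw [blockForm_append_left hv, DFA.mem_accepts, DFA.eval, DFA.evalFrom_of_append]
      change M.evalFrom (M.eval _) _ ∈ _ at this
      change M.evalFrom (M.eval _) _ ∈ _
      rwa [← huv])
    exact h
  · rintro _ ⟨v, rfl⟩
    have := hno v i hlen
    unfold Misses at this
    push Not at this
    exact this hi

/-- If, at the end of `p` and `p'`, the automata for `U` are in the same situation when reading
them with `a` and `a'`, then the words and indices extending them in the same way miss each other
simultaneously. -/
theorem misses_congr {σ τ : Type*} {M : DFA (Option Bool × Option Bool) σ} {N : DFA Bool τ}
    (hM : ∀ x i, (∃ h : i ∈ U.index, x ∈ U.lang ⟨i, h⟩) ↔ blockForm x i ∈ M.accepts)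
    (hN : N.accepts = U.index) {p a p' a' : List Bool} (ha : a.length = p.length)
    (ha' : a'.length = p'.length) (hNa : N.eval a = N.eval a')
    (hMp : M.eval (blockForm p a) = M.eval (blockForm p' a'))
    (hpre : ∀ x', x' <+: p' → ∃ x, x <+: p ∧ M.eval (blockForm x a) = M.eval (blockForm x' a'))
    {y b : List Bool} (h : U.Misses (p ++ y) (a ++ b)) : U.Misses (p' ++ y) (a' ++ b) := by
  have transfer : ∀ {u v z : List (Option Bool × Option Bool)}, M.eval u = M.eval v →
      u ++ z ∈ M.accepts → v ++ z ∈ M.accepts := by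
    intro u v z huv hu
    change z ∈ M.accepts.leftQuotient u at hu
    change z ∈ M.accepts.leftQuotient v
    rwa [Language.leftQuotient_accepts_apply, ← huv, ← Language.leftQuotient_accepts_apply]
  obtain ⟨hi, h⟩ := h
  have hi' : a' ++ b ∈ U.index := by
    rw [← hN] at hi ⊢
    change b ∈ N.accepts.leftQuotient a at hi
    change b ∈ N.accepts.leftQuotient a'
    rwa [Language.leftQuotient_accepts_apply, ← hNa, ← Language.leftQuotient_accepts_apply]
  refine ⟨hi', fun x' hx' hc => ?_⟩
  have hx' := (hM x' (a' ++ b)).1 ⟨hi', hx'⟩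
  -- Words ending within `p'` are matched through `hpre`, those passing its end through `hMp`.
  rcases prefixComparable_append_iff.1 hc with hc | ⟨z, rfl, hz⟩
  · obtain ⟨x, hxp, hx⟩ := hpre x' hc
    rw [blockForm_append_right (ha' ▸ hc.length_le)] at hx'
    have := transfer hx.symm hx'
    rw [← blockForm_append_right (ha ▸ hxp.length_le)] at this
    obtain ⟨_, hxU⟩ := (hM _ _).2 this
    exact h x hxU (prefixComparable_append_iff.2 (.inl hxp))
  · rw [blockForm_append ha'.symm] at hx'
    have := transfer hMp.symm hx'
    rw [← blockForm_append ha.symm] at this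
    obtain ⟨_, hxU⟩ := (hM _ _).2 this
    exact h (p ++ z) hxU (prefixComparable_append_iff.2 (.inr ⟨z, rfl, hz⟩))

variable {U} in
/-- For a test `U` some word `w` is such that every sequence having `w` as a subword is outside the
covering region. -/
theorem IsART.exists_word (hU : U.IsART) : ∃ w : List Bool, ∀ p, ∃ i, U.Misses (p ++ w) i := by
  obtain ⟨L, ⟨σ, _, M, rfl⟩, hM⟩ := U.isAutomatic
  obtain ⟨τ, _, N, hN⟩ := U.index_isRegular
  let situation (p a : List Bool) : σ × Set σ × τ :=
    (M.eval (blockForm p a), {q | ∃ x, x <+: p ∧ M.eval (blockForm x a) = q}, N.eval a)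
  obtain ⟨w, hw⟩ := exists_uniform_word
    -- The index may vary with `p`, so the colour collects the situations over all `a` of length
    -- `|p|`.
    (fun p => {t | ∃ a : List Bool, a.length = p.length ∧ situation p a = t})
    (fun p w => ∃ i, p.length ≤ i.length ∧ U.Misses (p ++ w) i)
    (fun p w z ⟨i, hi, h⟩ => ⟨i, hi, by simpa using h.append z⟩) (by
    intro c w
    by_cases hc : ∃ p : List Bool, {t | ∃ a : List Bool, a.length = p.length ∧
      situation p a = t} = c
    · obtain ⟨p, rfl⟩ := hc
      obtain ⟨v, i, hi, h⟩ := hU.exists_misses (p ++ w)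
      refine ⟨v, fun p' hp' => ?_⟩
      have hpi : p.length ≤ i.length := by simp at hi; omega
      have ha : (i.take p.length).length = p.length := by simpa using hpi
      obtain ⟨a', ha', hs⟩ := hp'.ge ⟨i.take p.length, ha, rfl⟩
      simp only [situation, Prod.mk.injEq] at hs
      -- The index for `p'` replaces the first `|p|` letters of `i` by an `a'` in the same situation
      -- and keeps the rest.
      refine ⟨a' ++ i.drop p.length, by simp [ha'], ?_⟩
      refine U.misses_congr hM hN ha ha' hs.2.2.symm hs.1.symm
        (fun x' hx' => hs.2.1.le ⟨x', hx', rfl⟩) ?_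
      rwa [List.take_append_drop, ← List.append_assoc]
    · exact ⟨[], fun p hp => absurd ⟨p, hp⟩ hc⟩)
  exact ⟨w, fun p => (hw p).imp fun _ h => h.2⟩

end AutomaticFamily

/-! ### The rate `γ` and the conclusion -/

theorem exists_pow_eq_one_sub (m : ℕ) (hm : m ≠ 0) :
    ∃ γ : ℝ, 0 < γ ∧ γ < 1 ∧ γ ^ m = 1 - 2⁻¹ ^ m := by
  have h1 : (0 : ℝ) < 1 - 2⁻¹ ^ m := sub_pos.2 (pow_lt_one₀ (by norm_num) (by norm_num) hm)
  have h2 : (1 : ℝ) - 2⁻¹ ^ m < 1 := sub_lt_self _ (by positivity)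
  have hm' : (0 : ℝ) < (m : ℝ)⁻¹ := by positivity
  exact ⟨_, Real.rpow_pos_of_pos h1 (m : ℝ)⁻¹, Real.rpow_lt_one h1.le h2 hm',
    Real.rpow_inv_natCast_pow h1.le hm⟩

theorem AutomaticFamily.isART_of_le_pow (V : AutomaticFamily) [Infinite {j // j ∈ V.index}]
    {γ : ℝ} (h0 : 0 < γ) (h1 : γ < 1)
    (h : ∀ j : {j // j ∈ V.index},
      cantorMeasure (openClass (V.lang j)) ≤ ENNReal.ofReal (γ ^ (j : List Bool).length)) :
    V.IsART := by
  have hlen : Filter.Tendsto (fun j : {j // j ∈ V.index} => (j : List Bool).length)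
      Filter.cofinite Filter.atTop := by
    refine Filter.tendsto_atTop.2 fun n => Filter.mem_cofinite.2 ?_
    refine ((List.finite_length_lt Bool n).preimage
      (Subtype.val_injective (p := fun i => i ∈ V.index)).injOn).subset fun i hi => ?_
    simpa using hi
  have hlim := (ENNReal.tendsto_ofReal (tendsto_pow_atTop_nhds_zero_of_lt_one h0.le h1)).comp hlen
  rw [ENNReal.ofReal_zero] at hlim
  -- Infinitely many indices make `cofinite` a proper filter, so the limit is the lower limit.
  exact (tendsto_of_tendsto_of_tendsto_of_le_of_le tendsto_const_nhds hlim
    (fun _ => zero_le) h).liminf_eq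

theorem theorem12 (U : AutomaticFamily) (hU : U.IsART) :
    ∃ (V : AutomaticFamily) (γ : ℝ) (w : List Bool),
      V.IsART ∧
      U.coveringRegion ⊆ V.coveringRegion ∧
      0 < γ ∧ γ < 1 ∧
      (∀ j : {j : List Bool // j ∈ V.index},
        cantorMeasure (openClass (V.lang j)) ≤ ENNReal.ofReal (γ ^ (j : List Bool).length)) ∧
      w ≠ [] ∧
      (∀ j : List Bool, j ∈ V.index ↔
        ∃ k : ℕ, 1 ≤ k ∧ j = List.replicate (w.length * k) false) ∧
      (∀ j : {j : List Bool // j ∈ V.index},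
        V.lang j = avoiding w (j : List Bool).length) := by
  obtain ⟨w₀, hw₀⟩ := hU.exists_word
  obtain ⟨w, hwne, hw⟩ : ∃ w : List Bool, w ≠ [] ∧ ∀ p, ∃ i, U.Misses (p ++ w) i :=
    -- Missing persists under extension, so a letter may be added to ensure `w ≠ []`.
    ⟨w₀ ++ [false], by simp, fun p => (hw₀ p).imp fun i h => by simpa using h.append [false]⟩
  have hm : w.length ≠ 0 := by simpa using hwne
  obtain ⟨γ, h0, h1, hγ⟩ := exists_pow_eq_one_sub w.length hm
  have hbound : ∀ j : {j : List Bool // j ∈ (avoidingFamily w hwne).index},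
      cantorMeasure (openClass ((avoidingFamily w hwne).lang j)) ≤
        ENNReal.ofReal (γ ^ (j : List Bool).length) := by
    rintro ⟨_, k, hk, rfl⟩
    change cantorMeasure (openClass (avoiding w (List.replicate _ false).length)) ≤ _
    simp only [List.length_replicate]
    rw [pow_mul, hγ]
    exact cantorMeasure_openClass_avoiding_le w k
  have : Infinite {j // j ∈ (avoidingFamily w hwne).index} := infinite_zeroWords hm
  refine ⟨avoidingFamily w hwne, γ, w, AutomaticFamily.isART_of_le_pow _ h0 h1 hbound, ?_, h0, h1,
    hbound, hwne, fun j => Iff.rfl, fun j => rfl⟩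
  refine fun X hX => Set.mem_iInter.2 fun j => ?_
  refine ⟨seqPrefix X (j : List Bool).length, ⟨length_seqPrefix _ _, ?_⟩,
    isPrefixOfSeq_seqPrefix _ _⟩
  -- An occurrence of `w` after `p` would put `X` in the cylinder of `p ++ w`, which misses some
  -- `[U_i]`.
  rintro ⟨p, s, hps⟩
  obtain ⟨i, hi⟩ := hw p
  refine hi.notMem_coveringRegion ((isPrefixOfSeq_seqPrefix X (j : List Bool).length).of_prefix
    (hps ▸ List.prefix_append _ _)) hX
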